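/- Let $n\ge 4$, let $\mathcal A_n=\{1<2<\cdots<n\}$, and let $\mathsf{baxt}_n=\mathcal A_n^\star/\!\equiv$ be the Baxter monoid of rank $n$, where $u\equiv v$ if and only if $u$ and $v$ have the same pair of twin binary search trees: the left strict binary search tree obtained by inserting the letters from left to right (a letter $a$ goes to the left of a node $x$ if $a<x$, and to the right otherwise) and the right strict binary search tree obtained by inserting the letters from right to left ($a$ goes to the right of $x$ if $a>x$, and to the left otherwise). Let $^\sharp$ be Schützenberger's involution on $\mathsf{baxt}_n$, induced by $w_1w_2\cdots w_k\mapsto w_k^\sharp\cdots w_2^\sharp w_1^\sharp$ with $i^\sharp=n+1-i$. Terms are built from a countably infinite set $\mathcal X$ of variables and the empty word by (associative) concatenation and a formal unary operation $^*$. An identity $s\approx t$ (a pair of terms) is satisfied by $(\mathsf{baxt}_n,{}^\sharp)$ if $s$ and $t$ take the same value under every assignment $\mathcal X\to\mathsf{baxt}_n$, with $^*$ interpreted as $^\sharp$ and the empty word as the unit. It is deducible from a set $\Sigma$ of identities if there is a finite sequence of terms from $s$ to $t$ in which each term arises from the previous one by replacing a subterm $\varphi(p)$ by $\varphi(q)$,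 where $p\approx q$ or $q\approx p$ is in $\Sigma$ and $\varphi$ is a substitution of terms (possibly the empty word) for variables. A set $\Sigma$ is an identity basis for $(\mathsf{baxt}_n,{}^\sharp)$ if all identities in $\Sigma$ are satisfied by it and every identity that it satisfies is deducible from $\Sigma$. Then the four identities $$(x^*)^*\approx x,\qquad (xy)^*\approx y^*x^*,$$ $$xhyk\,xy\,sxty\approx xhyk\,yx\,sxty,\qquad xhyk\,xy\,sytx\approx xhyk\,yx\,sytx$$ form a (finite) identity basis for $(\mathsf{baxt}_n,{}^\sharp)$. -/

import Mathlib

namespace BaxterMonoid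

section Trees

variable {α : Type*} [LinearOrder α]

/-- Insertion of `a` into a left strict binary search tree: labels smaller than the root go
to the left, all other labels go to the right. -/
def insertLeftStrict : BinaryTree α → α → BinaryTree α
  | .nil, a => .node a .nil .nil
  | .node x l r, a =>
      if a < x then .node x (insertLeftStrict l a) r else .node x l (insertLeftStrict r a)

/-- Insertion of `a` into a right strict binary search tree: labels greater than the root go
to the right, all other labels go to the left. -/
def insertRightStrict : BinaryTree α → α → BinaryTree α
  | .nil, a => .node a .nil .nil
  | .node x l r, a =>
      if x < a then .node x l (insertRightStrict r a) else .node x (insertRightStrict l a) r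

/-- The left strict binary search tree of a word (read from left to right). -/
def leftStrictTree (w : List α) : BinaryTree α :=
  w.foldl insertLeftStrict .nil

/-- The right strict binary search tree of a word (read from right to left). -/
def rightStrictTree (w : List α) : BinaryTree α :=
  w.foldr (fun a T => insertRightStrict T a) .nil

/-- The pair of twin binary search trees of a word. -/
def twinTrees (w : List α) : BinaryTree α × BinaryTree α :=
  (leftStrictTree w, rightStrictTree w)

theorem foldl_insert_node (w : List α) (x : α) (l r : BinaryTree α) :
    w.foldl insertLeftStrict (.node x l r) =
      .node x ((w.filter (fun b => decide (b < x))).foldl insertLeftStrict l)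
        ((w.filter (fun b => decide (x ≤ b))).foldl insertLeftStrict r) := by
  induction w generalizing l r with
  | nil => rfl
  | cons a w ih =>
    by_cases h : a < x
    · have h' : ¬ x ≤ a := not_le.mpr h
      simp [insertLeftStrict, h, h', ih]
    · have h' : x ≤ a := not_lt.mp h
      simp [insertLeftStrict, h, h', ih]

theorem leftStrictTree_cons (x : α) (w : List α) :
    leftStrictTree (x :: w) =
      .node x (leftStrictTree (w.filter (fun b => decide (b < x))))
        (leftStrictTree (w.filter (fun b => decide (x ≤ b)))) :=
  foldl_insert_node w x .nil .nil

/-- Deletion of all labels `≥ a` from a left strict binary search tree. -/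
def restrictLT (a : α) : BinaryTree α → BinaryTree α
  | .nil => .nil
  | .node x l r => if x < a then .node x (restrictLT a l) (restrictLT a r) else restrictLT a l

/-- Deletion of all labels `< a` from a left strict binary search tree. -/
def restrictGE (a : α) : BinaryTree α → BinaryTree α
  | .nil => .nil
  | .node x l r => if a ≤ x then .node x (restrictGE a l) (restrictGE a r) else restrictGE a r

theorem leftStrictTree_filter_lt (a : α) (w : List α) :
    leftStrictTree (w.filter (fun b => decide (b < a))) = restrictLT a (leftStrictTree w) := by
  induction hn : w.length using Nat.strong_induction_on generalizing w with
  | _ n ih =>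
    subst hn
    cases w with
    | nil => rfl
    | cons x w =>
      have ih1 := ih _ (Nat.lt_succ_of_le (List.length_filter_le (fun b => decide (b < x)) w))
        (w.filter (fun b => decide (b < x))) rfl
      have ih2 := ih _ (Nat.lt_succ_of_le (List.length_filter_le (fun b => decide (x ≤ b)) w))
        (w.filter (fun b => decide (x ≤ b))) rfl
      rw [leftStrictTree_cons, restrictLT, ← ih1, ← ih2]
      by_cases h : x < a
      · rw [if_pos h, List.filter_cons_of_pos (by simpa using h), leftStrictTree_cons]
        simp only [List.filter_filter, Bool.and_comm]
      · rw [if_neg h, List.filter_cons_of_neg (by simpa using h), List.filter_filter]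
        congr 1
        apply List.filter_congr
        intro b _
        have := not_lt.mp h
        by_cases hb : b < a
        · simp [hb, hb.trans_le this]
        · simp [hb]

theorem leftStrictTree_filter_ge (a : α) (w : List α) :
    leftStrictTree (w.filter (fun b => decide (a ≤ b))) = restrictGE a (leftStrictTree w) := by
  induction hn : w.length using Nat.strong_induction_on generalizing w with
  | _ n ih =>
    subst hn
    cases w with
    | nil => rfl
    | cons x w =>
      have ih1 := ih _ (Nat.lt_succ_of_le (List.length_filter_le (fun b => decide (b < x)) w))
        (w.filter (fun b => decide (b < x))) rfl
      have ih2 := ih _ (Nat.lt_succ_of_le (List.length_filter_le (fun b => decide (x ≤ b)) w))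
        (w.filter (fun b => decide (x ≤ b))) rfl
      rw [leftStrictTree_cons, restrictGE, ← ih1, ← ih2]
      by_cases h : a ≤ x
      · rw [if_pos h, List.filter_cons_of_pos (by simpa using h), leftStrictTree_cons]
        simp only [List.filter_filter, Bool.and_comm]
      · rw [if_neg h, List.filter_cons_of_neg (by simpa using h), List.filter_filter]
        congr 1
        apply List.filter_congr
        intro b _
        have := not_le.mp h
        by_cases hb : a ≤ b
        · simp [hb, (this.trans_le hb).le]
        · simp [hb]

theorem leftStrictTree_append_congr {u u' v v' : List α}
    (hu : leftStrictTree u = leftStrictTree u') (hv : leftStrictTree v = leftStrictTree v') :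
    leftStrictTree (u ++ v) = leftStrictTree (u' ++ v') := by
  have hleft : ∀ w : List α, leftStrictTree (w ++ v) = leftStrictTree (w ++ v') := by
    intro w
    induction w with
    | nil => exact hv
    | cons a w ih =>
      rw [List.cons_append, List.cons_append, leftStrictTree_cons, leftStrictTree_cons,
        leftStrictTree_filter_lt, leftStrictTree_filter_lt, leftStrictTree_filter_ge,
        leftStrictTree_filter_ge, ih]
  rw [hleft u]
  unfold leftStrictTree at hu ⊢
  rw [List.foldl_append, List.foldl_append, hu]

end Trees

/-- Schützenberger's involution on words over the alphabet `Fin n`, which plays the part of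
`{1 < 2 < ⋯ < n}`: reverse the word and apply the order-reversing permutation to its letters. -/
def sharp {n : ℕ} (w : List (Fin n)) : List (Fin n) :=
  (w.map Fin.rev).reverse

theorem sharp_sharp {n : ℕ} (w : List (Fin n)) : sharp (sharp w) = w := by
  simp [sharp, Function.comp_def]

theorem sharp_append {n : ℕ} (u v : List (Fin n)) : sharp (u ++ v) = sharp v ++ sharp u := by
  simp [sharp]

/-- The mirror image of a tree, with order-reversed labels. -/
def mirror {n : ℕ} : BinaryTree (Fin n) → BinaryTree (Fin n)
  | .nil => .nil
  | .node x l r => .node x.rev (mirror r) (mirror l)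

theorem mirror_mirror {n : ℕ} (T : BinaryTree (Fin n)) : mirror (mirror T) = T := by
  induction T with
  | nil => rfl
  | node x l r ihl ihr => simp [mirror, ihl, ihr]

theorem insertRightStrict_mirror {n : ℕ} (T : BinaryTree (Fin n)) (a : Fin n) :
    insertRightStrict (mirror T) a.rev = mirror (insertLeftStrict T a) := by
  induction T with
  | nil => rfl
  | node x l r ihl ihr =>
    by_cases h : a < x
    · simp [mirror, insertRightStrict, insertLeftStrict, h, ihl]
    · simp [mirror, insertRightStrict, insertLeftStrict, h, ihr]

theorem rightStrictTree_sharp {n : ℕ} (w : List (Fin n)) :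
    rightStrictTree (sharp w) = mirror (leftStrictTree w) := by
  induction w using List.reverseRecOn with
  | nil => rfl
  | append_singleton w a ih =>
    rw [sharp_append]
    change insertRightStrict (rightStrictTree (sharp w)) a.rev = _
    rw [ih, insertRightStrict_mirror]
    simp [leftStrictTree]

theorem leftStrictTree_sharp {n : ℕ} (w : List (Fin n)) :
    leftStrictTree (sharp w) = mirror (rightStrictTree w) := by
  rw [← mirror_mirror (leftStrictTree (sharp w)), ← rightStrictTree_sharp, sharp_sharp]

theorem rightStrictTree_append_congr {n : ℕ} {u u' v v' : List (Fin n)}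
    (hu : rightStrictTree u = rightStrictTree u') (hv : rightStrictTree v = rightStrictTree v') :
    rightStrictTree (u ++ v) = rightStrictTree (u' ++ v') := by
  have h := leftStrictTree_append_congr (u := sharp v) (u' := sharp v') (v := sharp u)
    (v' := sharp u') (by rw [leftStrictTree_sharp, leftStrictTree_sharp, hv])
    (by rw [leftStrictTree_sharp, leftStrictTree_sharp, hu])
  rw [← sharp_append, ← sharp_append, leftStrictTree_sharp, leftStrictTree_sharp] at h
  rw [← mirror_mirror (rightStrictTree (u ++ v)), h, mirror_mirror]

theorem twinTrees_sharp_congr {n : ℕ} {u v : List (Fin n)} (h : twinTrees u = twinTrees v) :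
    twinTrees (sharp u) = twinTrees (sharp v) := by
  unfold twinTrees at h ⊢
  rw [Prod.mk.injEq] at h
  rw [leftStrictTree_sharp, leftStrictTree_sharp, rightStrictTree_sharp, rightStrictTree_sharp,
    h.1, h.2]

/-- The Baxter congruence on the free monoid: two words are congruent if and only if they have
the same pair of twin binary search trees. -/
def baxterCon (n : ℕ) : Con (FreeMonoid (Fin n)) where
  r u v := twinTrees u.toList = twinTrees v.toList
  iseqv := ⟨fun _ => rfl, fun h => h.symm, fun h h' => h.trans h'⟩
  mul' {u u' v v'} h h' := by
    change twinTrees _ = twinTrees _ at h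
    change twinTrees _ = twinTrees _ at h'
    change twinTrees (u.toList ++ v.toList) = twinTrees (u'.toList ++ v'.toList)
    unfold twinTrees at h h' ⊢
    rw [Prod.mk.injEq] at h h' ⊢
    exact ⟨leftStrictTree_append_congr h.1 h'.1, rightStrictTree_append_congr h.2 h'.2⟩

/-- The Baxter monoid of rank `n`. -/
def Baxt (n : ℕ) : Type :=
  (baxterCon n).Quotient

instance (n : ℕ) : Monoid (Baxt n) :=
  Con.monoid (baxterCon n)

/-- The class of a word in the Baxter monoid. -/
def Baxt.mk {n : ℕ} (w : List (Fin n)) : Baxt n :=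
  (baxterCon n).toQuotient (FreeMonoid.ofList w)

/-- Schützenberger's involution on the Baxter monoid, as `star`. -/
instance (n : ℕ) : StarMul (Baxt n) where
  star := Quotient.map' (s₁ := (baxterCon n).toSetoid) (s₂ := (baxterCon n).toSetoid)
    (fun w => FreeMonoid.ofList (sharp w.toList)) (fun _ _ h => twinTrees_sharp_congr h)
  star_involutive := by
    rintro ⟨w⟩
    exact congrArg (Baxt.mk (n := n)) (sharp_sharp w.toList)
  star_mul := by
    rintro ⟨u⟩ ⟨v⟩
    exact congrArg (Baxt.mk (n := n)) (sharp_append u.toList v.toList)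

theorem Baxt.mk_surjective {n : ℕ} : Function.Surjective (Baxt.mk (n := n)) := by
  rintro ⟨w⟩
  exact ⟨w.toList, rfl⟩

theorem Baxt.mk_eq_mk {n : ℕ} {u v : List (Fin n)} :
    Baxt.mk u = Baxt.mk v ↔ twinTrees u = twinTrees v :=
  (baxterCon n).eq

theorem Baxt.mk_append {n : ℕ} (u v : List (Fin n)) :
    Baxt.mk (u ++ v) = Baxt.mk u * Baxt.mk v := rfl

theorem Baxt.mk_nil {n : ℕ} : Baxt.mk ([] : List (Fin n)) = 1 := rfl

theorem Baxt.star_mk {n : ℕ} (w : List (Fin n)) : star (Baxt.mk w) = Baxt.mk (sharp w) := rfl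

/-- Terms over the countably infinite alphabet `ℕ`: a term is a finite (possibly empty) string of
symbols, each of which is a variable `x` or a starred term `s^*`. That is, the terms are built
from the variables and the empty word by (associative) concatenation and `^*`. -/
inductive InvTerm : Type
  | empty : InvTerm
  | consVar : ℕ → InvTerm → InvTerm
  | consStar : InvTerm → InvTerm → InvTerm

namespace InvTerm

/-- Concatenation of terms. -/
def append : InvTerm → InvTerm → InvTerm
  | empty, t' => t'
  | consVar x t, t' => consVar x (append t t')
  | consStar s t, t' => consStar s (append t t')

theorem append_empty (t : InvTerm) : t.append empty = t := by
  induction t with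
  | empty => rfl
  | consVar x t ih => simp [append, ih]
  | consStar s t _ ih => simp [append, ih]

theorem append_assoc (a b c : InvTerm) : (a.append b).append c = a.append (b.append c) := by
  induction a with
  | empty => rfl
  | consVar x t ih => simp [append, ih]
  | consStar s t _ ih => simp [append, ih]

instance : Monoid InvTerm where
  mul := append
  one := empty
  mul_assoc := append_assoc
  one_mul _ := rfl
  mul_one := append_empty

/-- The formal star operation on terms (no law is imposed on it). -/
instance : Star InvTerm where
  star t := consStar t empty

/-- The variable `x` as a term. -/
def var (x : ℕ) : InvTerm := consVar x empty

/-- The value of a term in a monoid with a unary operation under an assignment of the variables.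
For values in `InvTerm` itself, this is the application of a substitution to a term. -/
def eval {M : Type*} [Monoid M] [Star M] (φ : ℕ → M) : InvTerm → M
  | empty => 1
  | consVar x t => φ x * eval φ t
  | consStar s t => star (eval φ s) * eval φ t

end InvTerm

/-- An identity `s ≈ t` is a pair of terms. -/
abbrev InvIdentity : Type := InvTerm × InvTerm

/-- `M` satisfies the identity `e`. -/
def Satisfies (M : Type*) [Monoid M] [Star M] (e : InvIdentity) : Prop :=
  ∀ φ : ℕ → M, e.1.eval φ = e.2.eval φ

/-- `Replaces p q s t`: the term `t` results from `s` by replacing one particular subterm `p`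
of `s` with `q`. -/
inductive Replaces (p q : InvTerm) : InvTerm → InvTerm → Prop
  | here : Replaces p q p q
  | mul_left (a : InvTerm) {s t : InvTerm} : Replaces p q s t → Replaces p q (a * s) (a * t)
  | mul_right (b : InvTerm) {s t : InvTerm} : Replaces p q s t → Replaces p q (s * b) (t * b)
  | star {s t : InvTerm} : Replaces p q s t → Replaces p q (star s) (star t)

/-- `s ≈ t` is directly deducible from the identity `e`: for some substitution, a subterm of `s`
that is an instance of one side of `e` is replaced by the corresponding instance of the other
side. -/
def DirectlyDeducible (e : InvIdentity) (s t : InvTerm) : Prop :=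
  ∃ φ : ℕ → InvTerm,
    Replaces (e.1.eval φ) (e.2.eval φ) s t ∨ Replaces (e.2.eval φ) (e.1.eval φ) s t

/-- The identity `e` is deducible from the set `E` of identities: there is a finite chain of
terms from one side to the other, in which each step is directly deducible from a member of the
set. -/
def Deducible (E : Set InvIdentity) (e : InvIdentity) : Prop :=
  Relation.ReflTransGen (fun s t => ∃ i ∈ E, DirectlyDeducible i s t) e.1 e.2

/-- `E` is an identity basis for `M`: it consists of identities of `M`, and every identity of
`M` is deducible from it. -/
def IsIdentityBasis (M : Type*) [Monoid M] [Star M] (E : Set InvIdentity) : Prop :=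
  (∀ e ∈ E, Satisfies M e) ∧ ∀ e : InvIdentity, Satisfies M e → Deducible E e

/-- The involution axioms `(x^*)^* ≈ x` and `(x y)^* ≈ y^* x^*`. -/
def involutionAxioms : Set InvIdentity :=
  let x := InvTerm.var 0
  let y := InvTerm.var 1
  {(star (star x), x), (star (x * y), star y * star x)}

/-- The two identities `xhyk xy sxty ≈ xhyk yx sxty` and `xhyk xy sytx ≈ xhyk yx sytx`. -/
def baxterIdentities : Set InvIdentity :=
  let x := InvTerm.var 0
  let y := InvTerm.var 1
  let h := InvTerm.var 2
  let k := InvTerm.var 3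
  let s := InvTerm.var 4
  let t := InvTerm.var 5
  {(x * h * y * k * x * y * s * x * t * y, x * h * y * k * y * x * s * x * t * y),
    (x * h * y * k * x * y * s * y * t * x, x * h * y * k * y * x * s * y * t * x)}

end BaxterMonoid

namespace BaxterMonoid

/-! ### Soundness -/

section Soundness

variable {α : Type*} [LinearOrder α]

/-! The involution axioms push every star down to the variables, so each term equals a word in
literals `x`, `x^*`, and an identity becomes a pair of words `u`, `v`. What `Baxt n` sees of such a
word is its profile: the letters altogether, before the first occurrence of each literal, and after
the last one.

Soundness: rearranging a factor all of whose letters occur both before and after it changes neither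
tree (`Baxt.mk_perm`). Conversely, if `Baxt n` with `n ≥ 4` satisfies `u ≈ v`, evaluations that keep
only one or two variables show that the profiles agree (`WordIdentity.sameProfile`). Words with
equal profiles are joined by swaps of adjacent letters that both occur earlier and later
(`SameProfile.reflTransGen`), and each such swap is an instance of one of the two Baxter identities
(`deducible_of_interiorSwap`). -/

theorem leftStrictTree_swap {a b : α} (hab : a < b) (p r : List α) (hb : b ∈ p) :
    leftStrictTree (p ++ a :: b :: r) = leftStrictTree (p ++ b :: a :: r) := by
  induction hn : p.length using Nat.strong_induction_on generalizing p r with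
  | _ n ih =>
    subst hn
    cases p with
    | nil => simp at hb
    | cons c p =>
      rw [List.cons_append, List.cons_append, leftStrictTree_cons, leftStrictTree_cons]
      simp only [List.filter_append]
      by_cases h1 : b < c
      · have h2 : a < c := hab.trans h1
        have hbp : b ∈ p := (List.mem_cons.mp hb).resolve_left h1.ne
        have := ih _ (Nat.lt_succ_of_le (List.length_filter_le (fun x => decide (x < c)) p))
          (p.filter (fun x => decide (x < c))) (r.filter (fun x => decide (x < c)))
          (by simp [hbp, h1]) rfl
        simp [h1, h2, not_le.mpr h1, not_le.mpr h2, this]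
      · have h1' := not_lt.mp h1
        by_cases h2 : a < c
        -- Here `a < c ≤ b`: the root `c` separates the two letters, so their order is lost. This
        -- must happen at the latest at the node `b` coming from `p`.
        · simp [h1, h1', h2, not_le.mpr h2]
        · have h2' := not_lt.mp h2
          have hbp : b ∈ p := (List.mem_cons.mp hb).resolve_left (h2'.trans_lt hab).ne'
          have := ih _ (Nat.lt_succ_of_le (List.length_filter_le (fun x => decide (c ≤ x)) p))
            (p.filter (fun x => decide (c ≤ x))) (r.filter (fun x => decide (c ≤ x)))
            (by simp [hbp, h1']) rfl
          simp [h1, h1', h2, h2', this]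

theorem leftStrictTree_perm {x y : List α} (h : x.Perm y) (p r : List α) (hx : x ⊆ p) :
    leftStrictTree (p ++ x ++ r) = leftStrictTree (p ++ y ++ r) := by
  induction h generalizing p with
  | nil => rfl
  | cons a _ ih =>
    have := ih (p ++ [a]) fun c hc => by simp [hx (List.mem_cons_of_mem a hc)]
    simpa using this
  | swap a b l =>
    have ha : a ∈ p := hx (by simp)
    have hb : b ∈ p := hx (by simp)
    rcases lt_trichotomy a b with h | rfl | h
    · simpa using (leftStrictTree_swap h p (l ++ r) hb).symm
    · rfl
    · simpa using leftStrictTree_swap h p (l ++ r) ha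
  | trans h₁ _ ih₁ ih₂ =>
    exact (ih₁ p hx).trans (ih₂ p fun c hc => hx (h₁.symm.subset hc))

end Soundness

/-- `sharp` turns right trees into mirrored left trees and exchanges prefix and suffix, so the
letters of `x` are now needed in `r`. -/
theorem rightStrictTree_perm {n : ℕ} {x y : List (Fin n)} (h : x.Perm y) (p r : List (Fin n))
    (hx : x ⊆ r) : rightStrictTree (p ++ x ++ r) = rightStrictTree (p ++ y ++ r) := by
  have hs : (sharp x).Perm (sharp y) :=
    (List.reverse_perm _).trans ((h.map _).trans (List.reverse_perm _).symm)
  have hsub : sharp x ⊆ sharp r := fun c hc => by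
    simp only [sharp, List.mem_reverse, List.mem_map] at hc ⊢
    obtain ⟨d, hd, rfl⟩ := hc
    exact ⟨d, hx hd, rfl⟩
  have := leftStrictTree_perm hs (sharp r) (sharp p) hsub
  rw [← sharp_append, ← sharp_append, ← sharp_append, ← sharp_append, leftStrictTree_sharp,
    leftStrictTree_sharp, ← List.append_assoc, ← List.append_assoc] at this
  rw [← mirror_mirror (rightStrictTree (p ++ x ++ r)), this, mirror_mirror]

theorem Baxt.mk_perm {n : ℕ} {x y : List (Fin n)} (h : x.Perm y) (p r : List (Fin n))
    (hp : x ⊆ p) (hr : x ⊆ r) : Baxt.mk (p ++ x ++ r) = Baxt.mk (p ++ y ++ r) :=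
  Baxt.mk_eq_mk.mpr (Prod.ext (leftStrictTree_perm h p r hp) (rightStrictTree_perm h p r hr))

/-! ### Terms as words in starred and unstarred variables -/

namespace InvTerm

section Eval

variable {M : Type*} [Monoid M] [Star M] (φ : ℕ → M)

@[simp]
theorem eval_var (x : ℕ) : eval φ (var x) = φ x := mul_one _

@[simp]
theorem eval_star (t : InvTerm) : eval φ (star t) = star (eval φ t) := mul_one _

@[simp]
theorem eval_mul (s t : InvTerm) : eval φ (s * t) = eval φ s * eval φ t := by
  induction s with
  | empty => exact (one_mul _).symm
  | consVar x s ih =>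
    change φ x * eval φ (s * t) = φ x * eval φ s * eval φ t
    rw [ih, mul_assoc]
  | consStar s s' _ ih =>
    change star (eval φ s) * eval φ (s' * t) = star (eval φ s) * eval φ s' * eval φ t
    rw [ih, mul_assoc]

end Eval

/-- A variable (sign `false`) or a starred variable (sign `true`). -/
abbrev Literal : Type := ℕ × Bool

/-- The involution exchanging `x` and `x^*`. -/
def flipStar (a : Literal) : Literal := (a.1, !a.2)

@[simp]
theorem flipStar_flipStar (a : Literal) : flipStar (flipStar a) = a := by simp [flipStar]

/-- The starred word of a word of literals. -/
def starWord (w : List Literal) : List Literal := (w.map flipStar).reverse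

/-- The word of literals obtained from a term by pushing all stars down to the variables. -/
def pushStars : InvTerm → List Literal
  | empty => []
  | consVar x t => (x, false) :: pushStars t
  | consStar s t => starWord (pushStars s) ++ pushStars t

/-- The value of a literal. -/
def evalLiteral {M : Type*} [Star M] (φ : ℕ → M) (a : Literal) : M :=
  if a.2 then star (φ a.1) else φ a.1

/-- The value of a word of literals. -/
def evalWord {M : Type*} [Monoid M] [Star M] (φ : ℕ → M) (w : List Literal) : M :=
  (w.map (evalLiteral φ)).prod

section EvalWord

variable {M : Type*} [Monoid M] [StarMul M] (φ : ℕ → M)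

theorem evalLiteral_flipStar (a : Literal) :
    evalLiteral φ (flipStar a) = star (evalLiteral φ a) := by
  obtain ⟨x, _ | _⟩ := a <;> simp [evalLiteral, flipStar]

theorem evalWord_starWord (w : List Literal) :
    evalWord φ (starWord w) = star (evalWord φ w) := by
  induction w with
  | nil => simp [evalWord, starWord]
  | cons a w ih =>
    have h : starWord (a :: w) = starWord w ++ [flipStar a] := by simp [starWord]
    rw [h]
    simp only [evalWord, List.map_append, List.prod_append, List.map_cons, List.map_nil,
      List.prod_cons, List.prod_nil, mul_one, star_mul, evalLiteral_flipStar] at ih ⊢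
    rw [ih]

theorem eval_eq_evalWord_pushStars (t : InvTerm) : eval φ t = evalWord φ (pushStars t) := by
  induction t with
  | empty => rfl
  | consVar x t ih => simp [eval, pushStars, ih, evalWord, evalLiteral]
  | consStar s t ihs iht =>
    have h := evalWord_starWord φ (pushStars s)
    rw [← ihs] at h
    rw [eval, iht, ← h]
    simp [pushStars, evalWord]

end EvalWord

end InvTerm

open InvTerm

theorem satisfies_baxterIdentities (n : ℕ) :
    ∀ e ∈ involutionAxioms ∪ baxterIdentities, Satisfies (Baxt n) e := by
  rintro e (he | he) φ
  · rcases he with rfl | rfl <;> simp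
  · obtain ⟨x, hx⟩ := Baxt.mk_surjective (φ 0)
    obtain ⟨y, hy⟩ := Baxt.mk_surjective (φ 1)
    obtain ⟨h, hh⟩ := Baxt.mk_surjective (φ 2)
    obtain ⟨k, hk⟩ := Baxt.mk_surjective (φ 3)
    obtain ⟨s, hs⟩ := Baxt.mk_surjective (φ 4)
    obtain ⟨t, ht⟩ := Baxt.mk_surjective (φ 5)
    rcases he with rfl | rfl
    · have := Baxt.mk_perm (x := x ++ y) (y := y ++ x) List.perm_append_comm
        (x ++ h ++ y ++ k) (s ++ x ++ t ++ y)
        (fun c hc => by simp at hc ⊢; tauto) (fun c hc => by simp at hc ⊢; tauto)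
      simpa [Baxt.mk_append, hx, hy, hh, hk, hs, ht, mul_assoc] using this
    · have := Baxt.mk_perm (x := x ++ y) (y := y ++ x) List.perm_append_comm
        (x ++ h ++ y ++ k) (s ++ y ++ t ++ x)
        (fun c hc => by simp at hc ⊢; tauto) (fun c hc => by simp at hc ⊢; tauto)
      simpa [Baxt.mk_append, hx, hy, hh, hk, hs, ht, mul_assoc] using this

/-! ### Words with the same first and last occurrences -/

section Profile

variable {α : Type*}

/-- The interchange of two adjacent letters both of which occur earlier and later. -/
def InteriorSwap (u v : List α) : Prop :=
  ∃ p a b r, u = p ++ a :: b :: r ∧ v = p ++ b :: a :: r ∧ a ∈ p ∧ b ∈ p ∧ a ∈ r ∧ b ∈ r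

/-- The letter `a` passes the letters of `x` one at a time from the right; each letter passed joins
the suffix. -/
theorem interiorSwap_move_left {a : α} {p r : List α} (hap : a ∈ p) (har : a ∈ r) (x : List α)
    (hxp : x ⊆ p) (hxr : x ⊆ r) :
    Relation.ReflTransGen InteriorSwap (p ++ (x ++ a :: r)) (p ++ a :: (x ++ r)) := by
  induction x using List.reverseRecOn generalizing r with
  | nil => exact .refl
  | append_singleton x b ih =>
    have hbp : b ∈ p := hxp (by simp)
    have hbr : b ∈ r := hxr (by simp)
    refine .head ⟨p ++ x, b, a, r, by simp, rfl, by simp [hbp], by simp [hap], hbr, har⟩ ?_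
    have := ih (r := b :: r) (by simp [har]) (fun c hc => hxp (by simp [hc]))
      (fun c hc => List.mem_cons_of_mem _ (hxr (by simp [hc])))
    simpa using this

variable [DecidableEq α]

/-- The part of a word before the first occurrence of `b`. -/
def before (b : α) (w : List α) : List α := w.takeWhile (fun c => decide (c ≠ b))

theorem before_append_of_mem {b : α} {p : List α} (h : b ∈ p) (r : List α) :
    before b (p ++ r) = before b p := by
  induction p with
  | nil => simp at h
  | cons c p ih =>
    by_cases hc : c = b
    · simp [before, hc]
    · have := ih ((List.mem_cons.mp h).resolve_left (Ne.symm hc))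
      simpa [before, hc] using this

theorem before_append_of_notMem {b : α} {p : List α} (h : b ∉ p) (r : List α) :
    before b (p ++ r) = p ++ before b r :=
  List.takeWhile_append_of_pos fun c hc => by
    simpa using fun hcb : c = b => h (hcb ▸ hc)

@[simp]
theorem before_nil (b : α) : before b [] = [] := rfl

@[simp]
theorem before_cons_self (b : α) (w : List α) : before b (b :: w) = [] := by simp [before]

theorem before_cons_of_ne {a b : α} (h : a ≠ b) (w : List α) :
    before b (a :: w) = a :: before b w := by simp [before, h]

theorem before_of_notMem {b : α} {p : List α} (h : b ∉ p) : before b p = p := by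
  simpa using before_append_of_notMem h []

theorem before_sublist (b : α) (w : List α) : (before b w).Sublist w :=
  List.takeWhile_sublist _

/-- Two words have the same profile if they have the same letters altogether, before the first
occurrence of each letter, and after the last occurrence of each letter. -/
def SameProfile (u v : List α) : Prop :=
  u.Perm v ∧ (∀ b, (before b u).Perm (before b v)) ∧
    ∀ b, (before b u.reverse).Perm (before b v.reverse)

theorem SameProfile.trans {u v w : List α} (h : SameProfile u v) (h' : SameProfile v w) :
    SameProfile u w :=
  ⟨h.1.trans h'.1, fun b => (h.2.1 b).trans (h'.2.1 b), fun b => (h.2.2 b).trans (h'.2.2 b)⟩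

/-- If `b` occurs in `p`, the cut falls inside `p`; otherwise `b` is in neither `x` nor `y`, and
these lie whole on the same side of the cut. -/
theorem before_perm {x y : List α} (h : x.Perm y) (p r : List α) (hx : x ⊆ p) (b : α) :
    (before b (p ++ (x ++ r))).Perm (before b (p ++ (y ++ r))) := by
  by_cases hb : b ∈ p
  · rw [before_append_of_mem hb, before_append_of_mem hb]
  · have hbx : b ∉ x := fun h => hb (hx h)
    have hby : b ∉ y := fun h' => hbx (h.symm.subset h')
    rw [before_append_of_notMem hb, before_append_of_notMem hb, before_append_of_notMem hbx,
      before_append_of_notMem hby]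
    exact (h.append_right _).append_left _

theorem SameProfile.of_perm {x y : List α} (h : x.Perm y) (p r : List α) (hp : x ⊆ p)
    (hr : x ⊆ r) : SameProfile (p ++ (x ++ r)) (p ++ (y ++ r)) := by
  refine ⟨(h.append_right _).append_left _, before_perm h p r hp, fun b => ?_⟩
  have := before_perm (((List.reverse_perm x).trans h).trans (List.reverse_perm y).symm)
    r.reverse p.reverse (by simpa using hr) b
  simpa using this

/-- This makes it legal to move `a` left across `v₁`. Each of the four failures would show in the
profile: at `a` through the length of the part before its first or after its last occurrence, at a
letter `c` of `v₁` through the number of `a`'s in the corresponding part. -/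
theorem SameProfile.first_letter {p u v₁ v₂ : List α} {a : α}
    (h : SameProfile (p ++ a :: u) (p ++ (v₁ ++ a :: v₂))) (ha : a ∉ v₁) (hv : v₁ ≠ []) :
    a ∈ p ∧ a ∈ v₂ ∧ v₁ ⊆ p ∧ v₁ ⊆ v₂ := by
  obtain ⟨h₀, h₁, h₂⟩ := h
  have h₀' : (a :: u).Perm (v₁ ++ a :: v₂) := (List.perm_append_left_iff p).mp h₀
  have hcount : u.count a = v₂.count a := by
    have := h₀'.count_eq a
    simp [List.count_eq_zero_of_not_mem ha] at this
    exact this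
  have hlen := h₀'.length_eq
  have hpos := List.length_pos_of_ne_nil hv
  simp only [List.length_cons, List.length_append] at hlen
  refine ⟨?_, ?_, fun c hc => ?_, fun c hc => ?_⟩
  · by_contra hap
    have := (h₁ a).length_eq
    rw [before_append_of_notMem hap, before_append_of_notMem hap, before_append_of_notMem ha]
      at this
    simp at this
    exact hv this
  · by_contra hav
    have hau : a ∉ u := by
      rw [← List.count_eq_zero, hcount, List.count_eq_zero]
      exact hav
    have := (h₂ a).length_eq
    simp only [List.reverse_append, List.reverse_cons, List.append_assoc, List.cons_append,
      List.nil_append] at this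
    rw [before_append_of_notMem (by simpa using hau),
      before_append_of_notMem (by simpa using hav)] at this
    simp at this
    omega
  · by_contra hcp
    have hca : a ≠ c := fun e => ha (e ▸ hc)
    have := (h₁ c).count_eq a
    rw [before_append_of_notMem hcp, before_append_of_notMem hcp, before_append_of_mem hc,
      before_cons_of_ne hca] at this
    have h0 : (before c v₁).count a = 0 :=
      List.count_eq_zero_of_not_mem fun h => ha ((before_sublist c v₁).subset h)
    simp [h0] at this
  · by_contra hcv
    have hca : a ≠ c := fun e => ha (e ▸ hc)
    have hcu : c ∈ u :=
      (List.mem_cons.mp (h₀'.symm.subset (by simp [hc]))).resolve_left (Ne.symm hca)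
    -- After the last `c`, the second word has all `a`'s of `v₂` and one more, while the first has
    -- at most those of `u`, which are equally many as in `v₂`.
    have := (h₂ c).count_eq a
    simp only [List.reverse_append, List.reverse_cons, List.append_assoc, List.cons_append,
      List.nil_append] at this
    rw [before_append_of_mem (by simpa using hcu),
      before_append_of_notMem (by simpa using hcv), before_cons_of_ne hca] at this
    have hle := (before_sublist c u.reverse).count_le a
    simp at this hle
    omega

/-- Greedy sorting: the first occurrence in `v` of the next letter of `u` is moved to the front, and
the common prefix `p` grows by that letter. -/
theorem SameProfile.reflTransGen_append {u : List α} (p v : List α)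
    (h : SameProfile (p ++ u) (p ++ v)) :
    Relation.ReflTransGen InteriorSwap (p ++ v) (p ++ u) := by
  induction u generalizing p v with
  | nil =>
    have : v = [] := by simpa using h.1.length_eq
    rw [this]
  | cons a u ih =>
    have hav : a ∈ v := ((List.perm_append_left_iff p).mp h.1).subset (by simp)
    obtain ⟨v₁, v₂, rfl, ha⟩ := List.eq_append_cons_of_mem hav
    have key : Relation.ReflTransGen InteriorSwap (p ++ (v₁ ++ a :: v₂)) (p ++ a :: (v₁ ++ v₂)) ∧
        SameProfile (p ++ (v₁ ++ a :: v₂)) (p ++ a :: (v₁ ++ v₂)) := by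
      by_cases hv : v₁ = []
      · subst hv
        exact ⟨.refl, .refl _, fun _ => .refl _, fun _ => .refl _⟩
      · obtain ⟨hap, hav, hp, hr⟩ := h.first_letter ha hv
        refine ⟨interiorSwap_move_left hap hav v₁ hp hr, ?_⟩
        have := SameProfile.of_perm (x := v₁ ++ [a]) (y := a :: v₁) List.perm_append_comm p v₂
          (by simp [hp, hap]) (by simp [hr, hav])
        simpa using this
    refine key.1.trans ?_
    have := ih (p ++ [a]) (v₁ ++ v₂) (by simpa using h.trans key.2)
    simpa using this

theorem SameProfile.reflTransGen {u v : List α} (h : SameProfile u v) :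
    Relation.ReflTransGen InteriorSwap v u :=
  SameProfile.reflTransGen_append [] v h

end Profile

/-! ### Identities of the Baxter monoid with involution -/

/-- The number of consecutive labels `a` on the right branch from the root. -/
def rootRun {α : Type*} [DecidableEq α] (a : α) : BinaryTree α → ℕ
  | .nil => 0
  | .node x _ r => if x = a then rootRun a r + 1 else 0

/-- Since `a` is minimal, below a root `a` all remaining letters go right, so the right branch
copies the word until a letter other than `a` appears. -/
theorem rootRun_leftStrictTree {α : Type*} [LinearOrder α] {a : α} {w : List α}
    (hw : ∀ c ∈ w, a ≤ c) :
    rootRun a (leftStrictTree w) = (w.takeWhile (fun c => decide (c = a))).length := by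
  induction w with
  | nil => rfl
  | cons x w ih =>
    rw [leftStrictTree_cons, rootRun]
    by_cases hx : x = a
    · subst hx
      have : w.filter (fun b => decide (x ≤ b)) = w :=
        List.filter_eq_self.mpr fun c hc => by simpa using hw c (by simp [hc])
      rw [this, ih fun c hc => hw c (by simp [hc])]
      simp
    · simp [hx]

/-- With all letters but `a` and `b` erased, the leading `z`'s are exactly the images of the `a`'s
before the first `b`. -/
theorem takeWhile_flatMap_length {α β : Type*} [DecidableEq α] [BEq α] [LawfulBEq α]
    [DecidableEq β] {a b : α} {z d : β}
    (hab : a ≠ b) (hd : d ≠ z) (ψ : α → List β) (ha : ψ a = [z]) (hb : ψ b = [d])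
    (hc : ∀ c, c ≠ a → c ≠ b → ψ c = []) (w : List α) :
    ((w.flatMap ψ).takeWhile (fun c => decide (c = z))).length = (before b w).count a := by
  induction w with
  | nil => rfl
  | cons c w ih =>
    rw [List.flatMap_cons]
    by_cases h1 : c = a
    · subst h1
      rw [ha, before_cons_of_ne hab]
      simpa using ih
    · by_cases h2 : c = b
      · subst h2
        simp [hb, hd]
      · rw [hc c h1 h2, before_cons_of_ne h2, List.count_cons_of_ne h1]
        simpa using ih

/-- The word that is the value of a literal when the variables take words as values. -/
def literalWord {n : ℕ} (f : ℕ → List (Fin n)) (a : Literal) : List (Fin n) :=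
  if a.2 then sharp (f a.1) else f a.1

theorem evalWord_mk {n : ℕ} (f : ℕ → List (Fin n)) (w : List Literal) :
    evalWord (fun x => Baxt.mk (f x)) w = Baxt.mk (w.flatMap (literalWord f)) := by
  induction w with
  | nil => rfl
  | cons a w ih =>
    rw [List.flatMap_cons, Baxt.mk_append, ← ih]
    obtain ⟨x, _ | _⟩ := a <;>
      simp [evalWord, evalLiteral, literalWord, Baxt.star_mk]

/-- Two words of literals take the same value under all assignments. -/
def WordIdentity (n : ℕ) (u v : List Literal) : Prop :=
  ∀ φ : ℕ → Baxt n, evalWord φ u = evalWord φ v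

theorem WordIdentity.starWord {n : ℕ} {u v : List Literal} (h : WordIdentity n u v) :
    WordIdentity n (starWord u) (starWord v) := fun φ => by
  rw [evalWord_starWord, evalWord_starWord, h φ]

theorem WordIdentity.leftStrictTree_eq {n : ℕ} {u v : List Literal} (h : WordIdentity n u v)
    (f : ℕ → List (Fin n)) :
    leftStrictTree (u.flatMap (literalWord f)) = leftStrictTree (v.flatMap (literalWord f)) := by
  have := h fun x => Baxt.mk (f x)
  rw [evalWord_mk, evalWord_mk, Baxt.mk_eq_mk] at this
  exact congrArg Prod.fst this

/-- The literal `a` is sent to the least letter and `b` to another one; the run at the root of the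
left tree then counts the `a`'s before the first `b`. -/
theorem WordIdentity.count_before {n : ℕ} (hn : 4 ≤ n) {u v : List Literal}
    (h : WordIdentity n u v) {a b : Literal} (hab : a ≠ b) :
    (before b u).count a = (before b v).count a := by
  have key (d : Fin n) (hd : d ≠ ⟨0, by omega⟩) (ψ : Literal → List (Fin n))
      (ha : ψ a = [⟨0, by omega⟩]) (hb : ψ b = [d]) (hc : ∀ c, c ≠ a → c ≠ b → ψ c = [])
      (ht : leftStrictTree (u.flatMap ψ) = leftStrictTree (v.flatMap ψ)) :
      (before b u).count a = (before b v).count a := by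
    have hmin (w : List (Fin n)) : ∀ c ∈ w, (⟨0, by omega⟩ : Fin n) ≤ c :=
      fun c _ => Fin.mk_le_of_le_val (Nat.zero_le _)
    have := congrArg (rootRun ⟨0, by omega⟩) ht
    rw [rootRun_leftStrictTree (hmin _), rootRun_leftStrictTree (hmin _),
      takeWhile_flatMap_length hab hd ψ ha hb hc, takeWhile_flatMap_length hab hd ψ ha hb hc]
      at this
    exact this
  obtain ⟨x, s⟩ := a
  obtain ⟨y, t⟩ := b
  by_cases hxy : x = y
  · subst hxy
    have hst : t = !s := by
      cases s <;> cases t <;> simp_all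
    subst hst
    -- Here `b` is the star of `a`, so its value is forced to be the reverse of the least letter. A
    -- starred `a` needs the last letter as the value of its variable.
    refine key ⟨n - 1, by omega⟩ (by simp [Fin.ext_iff]; omega)
      (literalWord fun z => if z = x then
        (if s then [⟨n - 1, by omega⟩] else [⟨0, by omega⟩]) else []) ?_ ?_ ?_
      (h.leftStrictTree_eq _)
    · cases s <;> simp [literalWord, sharp, Fin.ext_iff, Fin.val_rev]
      omega
    · cases s <;> simp [literalWord, sharp, Fin.ext_iff, Fin.val_rev]
    · rintro ⟨z, r⟩ h1 h2
      have : z ≠ x := by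
        rintro rfl
        cases s <;> cases r <;> simp_all
      simp [literalWord, sharp, this]
  · have ht := h.leftStrictTree_eq fun z => if z = x then
        (if s then [⟨n - 1, by omega⟩] else [⟨0, by omega⟩]) else if z = y then
        (if t then [⟨n - 2, by omega⟩] else [⟨1, by omega⟩]) else []
    -- The literals `a`, `b` have values `0`, `1`, and their stars `n - 1`, `n - 2`. Cutting the
    -- tree at `2` erases these stars because `2 ≤ n - 2`; this is where rank four is needed.
    have ht' := congrArg (restrictLT (⟨2, by omega⟩ : Fin n)) ht
    rw [← leftStrictTree_filter_lt, ← leftStrictTree_filter_lt, List.filter_flatMap,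
      List.filter_flatMap] at ht'
    have hyx : ¬ y = x := fun e => hxy e.symm
    have rev_last : (⟨n - 1, by omega⟩ : Fin n).rev = ⟨0, by omega⟩ := by
      simp only [Fin.ext_iff, Fin.val_rev]
      omega
    have rev_penultimate : (⟨n - 2, by omega⟩ : Fin n).rev = ⟨1, by omega⟩ := by
      simp only [Fin.ext_iff, Fin.val_rev]
      omega
    refine key ⟨1, by omega⟩ (by simp [Fin.ext_iff]) _ ?_ ?_ ?_ ht'
    · cases s <;> simp [literalWord, sharp, rev_last, Fin.lt_def]
    · cases t <;> simp [literalWord, sharp, rev_penultimate, Fin.lt_def, hyx]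
    · rintro ⟨z, r⟩ h1 h2
      by_cases hzx : z = x
      · subst hzx
        have hr : r = !s := by cases s <;> cases r <;> simp_all
        subst hr
        cases s <;> simp [literalWord, sharp, Fin.val_rev, Fin.lt_def] <;> omega
      · by_cases hzy : z = y
        · subst hzy
          have hr : r = !t := by cases t <;> cases r <;> simp_all
          subst hr
          cases t <;> simp [literalWord, sharp, Fin.val_rev, Fin.lt_def, hzx] <;> omega
        · simp [literalWord, sharp, hzx, hzy]

theorem WordIdentity.perm_before {n : ℕ} (hn : 4 ≤ n) {u v : List Literal}
    (h : WordIdentity n u v) (b : Literal) : (before b u).Perm (before b v) := by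
  refine List.perm_iff_count.mpr fun a => ?_
  by_cases hab : a = b
  · subst hab
    have h0 (w : List Literal) : (before a w).count a = 0 :=
      List.count_eq_zero_of_not_mem fun h => by simpa using List.mem_takeWhile_imp h
    rw [h0, h0]
  · exact h.count_before hn hab

/-- Starring a word exchanges last and first occurrences, so last occurrences need no separate study
of right trees. -/
theorem before_starWord (b : Literal) (w : List Literal) :
    (before (flipStar b) (starWord w)).map flipStar = before b w.reverse := by
  rw [starWord, ← List.map_reverse, before, List.takeWhile_map, List.map_map, before]
  have h1 : flipStar ∘ flipStar = id := funext flipStar_flipStar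
  have h2 : (fun c => decide (c ≠ flipStar b)) ∘ flipStar = fun c => decide (c ≠ b) := by
    funext c
    have : flipStar c = flipStar b ↔ c = b :=
      (Function.LeftInverse.injective flipStar_flipStar).eq_iff
    simp [this]
  rw [h1, h2, List.map_id]

theorem WordIdentity.sameProfile {n : ℕ} (hn : 4 ≤ n) {u v : List Literal}
    (h : WordIdentity n u v) : SameProfile u v := by
  refine ⟨?_, h.perm_before hn, fun b => ?_⟩
  -- For a literal that occurs in neither word, the part before it is the whole word.
  · obtain ⟨b, hb⟩ := Infinite.exists_notMem_finset (u ++ v).toFinset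
    simp only [List.mem_toFinset, List.mem_append, not_or] at hb
    have := h.perm_before hn b
    rwa [before_of_notMem hb.1, before_of_notMem hb.2] at this
  · rw [← before_starWord, ← before_starWord]
    exact (h.starWord.perm_before hn (flipStar b)).map flipStar

/-! ### Deductions -/

theorem Replaces.symm {p q s t : InvTerm} (h : Replaces p q s t) : Replaces q p t s := by
  induction h with
  | here => exact .here
  | mul_left a _ ih => exact .mul_left a ih
  | mul_right b _ ih => exact .mul_right b ih
  | star _ ih => exact .star ih

namespace Deducible

variable {E : Set InvIdentity} {s t r s' t' : InvTerm}

theorem refl (E : Set InvIdentity) (t : InvTerm) : Deducible E (t, t) :=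
  Relation.ReflTransGen.refl

theorem trans (h : Deducible E (s, t)) (h' : Deducible E (t, r)) : Deducible E (s, r) :=
  Relation.ReflTransGen.trans h h'

theorem symm (h : Deducible E (s, t)) : Deducible E (t, s) := by
  have : Std.Symm fun s t => ∃ i ∈ E, DirectlyDeducible i s t :=
    ⟨fun _ _ ⟨i, hi, φ, hφ⟩ => ⟨i, hi, φ, hφ.symm.imp Replaces.symm Replaces.symm⟩⟩
  exact Relation.ReflTransGen.stdSymm.symm _ _ h

theorem of_lift (f : InvTerm → InvTerm)
    (hf : ∀ p q a b, Replaces p q a b → Replaces p q (f a) (f b)) (h : Deducible E (s, t)) :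
    Deducible E (f s, f t) := by
  refine Relation.ReflTransGen.lift f ?_ _ _ h
  rintro a b ⟨i, hi, φ, hφ⟩
  exact ⟨i, hi, φ, hφ.imp (hf _ _ _ _) (hf _ _ _ _)⟩

theorem mul_left (a : InvTerm) (h : Deducible E (s, t)) : Deducible E (a * s, a * t) :=
  of_lift (a * ·) (fun _ _ _ _ => .mul_left a) h

theorem mul_right (a : InvTerm) (h : Deducible E (s, t)) : Deducible E (s * a, t * a) :=
  of_lift (· * a) (fun _ _ _ _ => .mul_right a) h

theorem mul (h : Deducible E (s, t)) (h' : Deducible E (s', t')) :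
    Deducible E (s * s', t * t') :=
  (mul_right s' h).trans (mul_left t h')

theorem star (h : Deducible E (s, t)) : Deducible E (star s, star t) :=
  of_lift Star.star (fun _ _ _ _ => .star) h

theorem of_mem {p q : InvTerm} (h : (p, q) ∈ E) (φ : ℕ → InvTerm) :
    Deducible E (p.eval φ, q.eval φ) :=
  .single ⟨_, h, φ, .inl .here⟩

end Deducible

/-! ### Deducing normal forms and interior swaps -/

section Completeness

variable {E : Set InvIdentity}

theorem deducible_star_star (hE : involutionAxioms ⊆ E) (t : InvTerm) :
    Deducible E (star (star t), t) := by
  have := Deducible.of_mem (hE (Or.inl rfl)) fun _ => t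
  simpa using this

theorem deducible_star_mul (hE : involutionAxioms ⊆ E) (s t : InvTerm) :
    Deducible E (star (s * t), star t * star s) := by
  have := Deducible.of_mem (hE (Or.inr rfl)) fun x => if x = 0 then s else t
  simpa using this

/-- Not an axiom, but `1^* ≈ 1^{**} 1^* ≈ (1 1^*)^* = 1^{**} ≈ 1`. -/
theorem deducible_star_one (hE : involutionAxioms ⊆ E) : Deducible E (star 1, 1) := by
  have h1 := deducible_star_mul hE 1 (star 1)
  rw [one_mul] at h1
  have h2 := (deducible_star_star hE 1).mul_right (star 1)
  rw [one_mul] at h2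
  exact (h1.trans h2).symm.trans (deducible_star_star hE 1)

/-- A literal as a term. -/
def ofLiteral (a : Literal) : InvTerm := if a.2 then star (var a.1) else var a.1

/-- A word of literals as a term. -/
def ofWord (w : List Literal) : InvTerm := (w.map ofLiteral).prod

@[simp]
theorem ofWord_nil : ofWord [] = 1 := rfl

@[simp]
theorem ofWord_cons (a : Literal) (w : List Literal) :
    ofWord (a :: w) = ofLiteral a * ofWord w := by simp [ofWord]

@[simp]
theorem ofWord_append (u v : List Literal) : ofWord (u ++ v) = ofWord u * ofWord v := by
  simp [ofWord]

theorem deducible_star_ofLiteral (hE : involutionAxioms ⊆ E) (a : Literal) :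
    Deducible E (star (ofLiteral a), ofLiteral (flipStar a)) := by
  obtain ⟨x, _ | _⟩ := a
  · exact Deducible.refl E _
  · exact deducible_star_star hE (var x)

theorem deducible_star_ofWord (hE : involutionAxioms ⊆ E) (w : List Literal) :
    Deducible E (star (ofWord w), ofWord (starWord w)) := by
  induction w with
  | nil => exact deducible_star_one hE
  | cons a w ih =>
    have h : ofWord (starWord (a :: w)) = ofWord (starWord w) * ofLiteral (flipStar a) := by
      simp [starWord]
    rw [ofWord_cons, h]
    exact (deducible_star_mul hE _ _).trans (ih.mul (deducible_star_ofLiteral hE a))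

theorem deducible_pushStars (hE : involutionAxioms ⊆ E) (t : InvTerm) :
    Deducible E (t, ofWord (pushStars t)) := by
  induction t with
  | empty => exact Deducible.refl E _
  | consVar x t ih =>
    rw [pushStars, ofWord_cons]
    exact ih.mul_left (var x)
  | consStar s t ihs iht =>
    rw [pushStars, ofWord_append]
    exact (ihs.star.trans (deducible_star_ofWord hE _)).mul iht

theorem exists_occurrences {α : Type*} {a b : α} (hab : a ≠ b) {p : List α} (ha : a ∈ p)
    (hb : b ∈ p) :
    ∃ p₁ p₂ p₃, p = p₁ ++ a :: (p₂ ++ b :: p₃) ∨ p = p₁ ++ b :: (p₂ ++ a :: p₃) := by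
  obtain ⟨q, r, rfl⟩ := List.append_of_mem ha
  rcases List.mem_append.mp hb with h | h
  · obtain ⟨q₁, q₂, rfl⟩ := List.append_of_mem h
    exact ⟨q₁, q₂, r, .inr (by simp)⟩
  · obtain ⟨r₁, r₂, rfl⟩ := List.append_of_mem ((List.mem_cons.mp h).resolve_left hab.symm)
    exact ⟨q, r₁, r₂, .inl rfl⟩

/-- The assignment of six terms to the variables of the Baxter identities. -/
def assign (x y h k s t : InvTerm) (i : ℕ) : InvTerm :=
  [x, y, h, k, s, t].getD i 1

theorem deducible_interior_swap (hE : baxterIdentities ⊆ E) (x y h k s t : InvTerm) :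
    Deducible E (x * h * y * k * x * y * s * x * t * y, x * h * y * k * y * x * s * x * t * y) ∧
    Deducible E (x * h * y * k * x * y * s * y * t * x,
      x * h * y * k * y * x * s * y * t * x) := by
  constructor
  · have := Deducible.of_mem (hE (Or.inl rfl)) (assign x y h k s t)
    simpa [assign] using this
  · have := Deducible.of_mem (hE (Or.inr rfl)) (assign x y h k s t)
    simpa [assign] using this

theorem deducible_of_interiorSwap (hE : baxterIdentities ⊆ E) {u v : List Literal}
    (h : InteriorSwap u v) : Deducible E (ofWord u, ofWord v) := by
  obtain ⟨p, a, b, r, rfl, rfl, hap, hbp, har, hbr⟩ := h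
  by_cases hab : a = b
  · subst hab
    exact Deducible.refl E _
  have key (x y h k s t l m : InvTerm) :=
    And.intro (((deducible_interior_swap hE x y h k s t).1.mul_left l).mul_right m)
      (((deducible_interior_swap hE x y h k s t).2.mul_left l).mul_right m)
  simp only [mul_assoc] at key
  -- The order of the earlier occurrences decides which letter plays `x`; if it is `b`, the identity
  -- is used backwards. The order of the later occurrences selects one of the two identities.
  obtain ⟨p₁, p₂, p₃, rfl | rfl⟩ := exists_occurrences hab hap hbp <;>
  obtain ⟨r₁, r₂, r₃, rfl | rfl⟩ := exists_occurrences hab har hbr <;>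
  simp only [ofWord_append, ofWord_cons, mul_assoc]
  · exact (key _ _ _ _ _ _ _ _).1
  · exact (key _ _ _ _ _ _ _ _).2
  · exact (key _ _ _ _ _ _ _ _).2.symm
  · exact (key _ _ _ _ _ _ _ _).1.symm

theorem deducible_of_reflTransGen (hE : baxterIdentities ⊆ E) {u v : List Literal}
    (h : Relation.ReflTransGen InteriorSwap u v) : Deducible E (ofWord u, ofWord v) := by
  induction h with
  | refl => exact Deducible.refl E _
  | tail _ h ih => exact ih.trans (deducible_of_interiorSwap hE h)

end Completeness

theorem deducible_of_satisfies {n : ℕ} (hn : 4 ≤ n) (e : InvIdentity)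
    (he : Satisfies (Baxt n) e) : Deducible (involutionAxioms ∪ baxterIdentities) e := by
  obtain ⟨s, t⟩ := e
  have hw : WordIdentity n (pushStars s) (pushStars t) := fun φ => by
    rw [← eval_eq_evalWord_pushStars, ← eval_eq_evalWord_pushStars]
    exact he φ
  have hs := deducible_pushStars (Set.subset_union_left (t := baxterIdentities)) s
  have ht := deducible_pushStars (Set.subset_union_left (t := baxterIdentities)) t
  have hst := deducible_of_reflTransGen (Set.subset_union_right (s := involutionAxioms))
    (hw.sameProfile hn).reflTransGen
  exact hs.trans (hst.symm.trans ht.symm)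

end BaxterMonoid

theorem mainTheorem2 (n : ℕ) (hn : 4 ≤ n) :
    (BaxterMonoid.involutionAxioms ∪ BaxterMonoid.baxterIdentities).Finite ∧
      BaxterMonoid.IsIdentityBasis (BaxterMonoid.Baxt n)
        (BaxterMonoid.involutionAxioms ∪ BaxterMonoid.baxterIdentities) :=
  ⟨(Set.toFinite {_, _}).union (Set.toFinite {_, _}),
    BaxterMonoid.satisfies_baxterIdentities n,
    fun e he => BaxterMonoid.deducible_of_satisfies hn e he⟩
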